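/- Let $\Phi$ be the standard normal distribution function. For an $n\times n$ correlation matrix $R$ (symmetric positive semidefinite with unit diagonal), the Gaussian copula with correlation matrix $R$ is the copula on $[0,1]^n$ which, when $R$ is invertible, has the density $c$ given by $$\log c(u_1,\dots,u_n)=-\tfrac12\log\det R-\tfrac12 z^\top(R^{-1}-I)z,\qquad z_i=\Phi^{-1}(u_i),$$ and which, when $R$ is singular, is the distribution function of $(\Phi(Z_1),\dots,\Phi(Z_n))$ with $Z\sim N(0,R)$. The bivariate Gaussian copula with correlation $\rho\in[-1,1]$ is the one with $n=2$ and $R=\begin{pmatrix}1&\rho\\ \rho&1\end{pmatrix}$. Given $d$-variate (inner) copulas $C^\diamond_{x_0}$, a factor quantile function $Q_0$, and bivariate (linking) copulas $C_1,\dots,C_d$, the outer copula of the corresponding extended one-factor copula is $$C(u_1,\dots,u_d)=\int_0^1 C^\diamond_{Q_0(u_0)}\Big[\frac{\partial C_1(u_1,u_0)}{\partial u_0},\dots,\frac{\partial C_d(u_d,u_0)}{\partial u_0}\Big]\,du_0,\qquad u\in[0,1]^d .$$ **Proposition.** Let $A$ be a $d\times d$ correlation matrix, let $\Delta=(\Delta_1,\dots,\Delta_d)^\top\in[-1,1]^d$,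 and let $D=\mathrm{diag}(1-\Delta_1^2,\dots,1-\Delta_d^2)$. Suppose that $C^\diamond_{x_0}=C_A$ for all $x_0$, where $C_A$ is the $d$-variate Gaussian copula with correlation matrix $A$, and that $C_i$ is the bivariate Gaussian copula with correlation $\Delta_i$, $i=1,\dots,d$. Then for every $u\in[0,1]^d$ the partial derivatives above exist for almost every $u_0\in(0,1)$, the integrand is integrable, and the outer copula $C$ is the Gaussian copula with correlation matrix $$R=D^{1/2}AD^{1/2}+\Delta\Delta^\top .$$ In particular $R$ is a correlation matrix; moreover, $R$ is invertible whenever $A$ is invertible and $|\Delta_i|<1$ for all $i$. -/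

import Mathlib

open MeasureTheory ProbabilityTheory Set

noncomputable section

namespace GaussCop

/-- The distribution function `Φ` of the standard normal law. -/
def stdNormalCdf (x : ℝ) : ℝ := cdf (gaussianReal 0 1) x

/-- The quantile of order `p` of the standard normal law; only the orders `p ∈ (0, 1)` matter. -/
def stdNormalQuantile (p : ℝ) : ℝ := sInf {x : ℝ | p ≤ stdNormalCdf x}

/-- `C` is a copula on `[0, 1]ⁿ` and `μ` is its law: `μ` is a probability measure with margins
uniform on `[0, 1]`, and on the unit cube `C` is the distribution function of `μ`.
The values of `C` outside the unit cube are irrelevant. -/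
structure IsCopulaWithLaw {n : ℕ} (μ : Measure (Fin n → ℝ)) (C : (Fin n → ℝ) → ℝ) : Prop where
  isProbabilityMeasure : IsProbabilityMeasure μ
  uniform_margin : ∀ i, μ.map (fun x => x i) = volume.restrict (Icc (0 : ℝ) 1)
  eq_cdf : ∀ u ∈ Icc (0 : Fin n → ℝ) 1, C u = μ.real (Iic u)

/-- A (possibly singular) correlation matrix. -/
structure IsCorrelationMatrix {n : ℕ} (R : Matrix (Fin n) (Fin n) ℝ) : Prop where
  posSemidef : R.PosSemidef
  diag_eq_one : ∀ i, R i i = 1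

/-- The Gaussian copula density: `log c(u) = -½ log det R - ½ zᵀ (R⁻¹ - I) z`, where `z i` is the
standard normal quantile of order `u i`. -/
def gaussianCopulaDensity {n : ℕ} (R : Matrix (Fin n) (Fin n) ℝ) (u : Fin n → ℝ) : ℝ :=
  let z : Fin n → ℝ := fun i => stdNormalQuantile (u i)
  Real.exp (-(1 / 2) * Real.log R.det - (1 / 2) * (z ⬝ᵥ ((R⁻¹ - 1).mulVec z)))

open Classical in
/-- The law on `[0, 1]ⁿ` of the Gaussian copula with correlation matrix `R`. For invertible `R` it
is given by its density. For singular `R`, where no density exists, it is the law of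
`(Φ(Z₁), …, Φ(Zₙ))` with `Z ∼ N(0, R)`. -/
def gaussianCopulaLaw {n : ℕ} (R : Matrix (Fin n) (Fin n) ℝ) : Measure (Fin n → ℝ) :=
  if IsUnit R then
    (volume.restrict (Icc (0 : Fin n → ℝ) 1)).withDensity
      (fun u => ENNReal.ofReal (gaussianCopulaDensity R u))
  else
    (multivariateGaussian 0 R).map (fun z i => stdNormalCdf (z i))

/-- `C` is a Gaussian copula with correlation matrix `R`. -/
structure IsGaussianCopula {n : ℕ} (R : Matrix (Fin n) (Fin n) ℝ) (C : (Fin n → ℝ) → ℝ) :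
    Prop where
  isCorrelationMatrix : IsCorrelationMatrix R
  isCopula : IsCopulaWithLaw (gaussianCopulaLaw R) C

/-- The `2 × 2` correlation matrix with correlation `ρ`. -/
def corrMatrix₂ (ρ : ℝ) : Matrix (Fin 2) (Fin 2) ℝ := !![1, ρ; ρ, 1]

/-- The integrand `C^◇_{Q₀(u₀)}(∂C₁(u₁, u₀)/∂u₀, …, ∂C_d(u_d, u₀)/∂u₀)` of an extended one-factor
copula with inner copulas `inner x₀`, factor quantile function `Q₀` and linking copulas `link i`. -/
def eofcIntegrand {d : ℕ} (inner : ℝ → (Fin d → ℝ) → ℝ) (Q₀ : ℝ → ℝ)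
    (link : Fin d → (Fin 2 → ℝ) → ℝ) (u : Fin d → ℝ) (u₀ : ℝ) : ℝ :=
  inner (Q₀ u₀) (fun i => deriv (fun t => link i ![u i, t]) u₀)

/-- The outer copula of an extended one-factor copula. -/
def eofcOuter {d : ℕ} (inner : ℝ → (Fin d → ℝ) → ℝ) (Q₀ : ℝ → ℝ)
    (link : Fin d → (Fin 2 → ℝ) → ℝ) (u : Fin d → ℝ) : ℝ :=
  ∫ u₀ in (0 : ℝ)..1, eofcIntegrand inner Q₀ link u u₀

/-- The integral defining the outer copula is meaningful: on the unit cube the partial derivatives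
exist for almost every `u₀ ∈ (0, 1)`, and the integrand is integrable. -/
structure EOFCWellDefined {d : ℕ} (inner : ℝ → (Fin d → ℝ) → ℝ) (Q₀ : ℝ → ℝ)
    (link : Fin d → (Fin 2 → ℝ) → ℝ) : Prop where
  differentiable : ∀ u ∈ Icc (0 : Fin d → ℝ) 1, ∀ i, ∀ᵐ u₀ ∂(volume.restrict (Ioo (0 : ℝ) 1)),
    DifferentiableAt ℝ (fun t => link i ![u i, t]) u₀
  integrable : ∀ u ∈ Icc (0 : Fin d → ℝ) 1,
    IntervalIntegrable (eofcIntegrand inner Q₀ link u) volume 0 1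

/-- `R = D^{1/2} A D^{1/2} + Δ Δᵀ` with `D = diag(1 - Δᵢ²)`. -/
def outerCorrelation {d : ℕ} (A : Matrix (Fin d) (Fin d) ℝ) (Δ : Fin d → ℝ) :
    Matrix (Fin d) (Fin d) ℝ :=
  Matrix.diagonal (fun i => Real.sqrt (1 - Δ i ^ 2)) * A *
      Matrix.diagonal (fun i => Real.sqrt (1 - Δ i ^ 2)) +
    Matrix.vecMulVec Δ Δ

end GaussCop

end

namespace GaussCop

open Filter Topology

/-! ### The standard normal distribution function and its inverse. -/

section StdNormal

/-! A Gaussian copula law, singular or not, is the image of `N(0, R)` under `Φ` in each coordinate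
(`gaussianCopulaLaw_eq_map`), so everything reduces to Gaussian vectors. If `Z₀` is standard normal
and independent of `V ∼ N(0, A)`, then `Δ Z₀ + D^{1/2} V ∼ N(0, R)`
(`map_factor_multivariateGaussian`). Conditioning on `Z₀ = z` writes the target distribution
function at `u` as the integral of `factorProb A Δ u z` over `z`.

A linking copula is the same model with inner matrix `1` and loadings `(ρ, 1)`, so `C(u, t)` is the
integral over `[0, t]` of `linkProb ρ u` at the normal quantile. Lebesgue differentiation then gives
its partial derivative almost everywhere.

Finally `Φ(w) ≤ linkProb ρ u z` holds exactly when `Φ(ρ z + √(1 - ρ²) w) ≤ u`. Hence `C_A` at the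
link derivatives is `factorProb`, and substituting `u₀ = Φ(z)` finishes the proof. -/

lemma stdNormalCdf_eq_real (x : ℝ) : stdNormalCdf x = (gaussianReal 0 1).real (Iic x) :=
  cdf_eq_real _ x

lemma ofReal_stdNormalCdf (x : ℝ) :
    ENNReal.ofReal (stdNormalCdf x) = gaussianReal 0 1 (Iic x) :=
  ofReal_cdf _ x

lemma stdNormalCdf_strictMono : StrictMono stdNormalCdf := by
  intro x y hxy
  have hpos : gaussianReal 0 1 (Ioc x y) ≠ 0 := fun h => by
    have := gaussianReal_absolutelyContinuous' 0 one_ne_zero h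
    rw [Real.volume_Ioc, ENNReal.ofReal_eq_zero] at this
    linarith
  have hsplit : (gaussianReal 0 1).real (Iic y) =
      (gaussianReal 0 1).real (Iic x) + (gaussianReal 0 1).real (Ioc x y) := by
    rw [← Iic_union_Ioc_eq_Iic hxy.le,
      measureReal_union (Iic_disjoint_Ioc le_rfl) measurableSet_Ioc]
  rw [stdNormalCdf_eq_real, stdNormalCdf_eq_real, hsplit]
  have : 0 < (gaussianReal 0 1).real (Ioc x y) :=
    ENNReal.toReal_pos hpos (measure_ne_top _ _)
  linarith

lemma continuous_stdNormalCdf : Continuous stdNormalCdf := by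
  rw [continuous_iff_continuousAt]
  intro x
  have hmono : Monotone (cdf (gaussianReal 0 1)) := monotone_cdf _
  refine (hmono.continuousAt_iff_leftLim_eq_rightLim).2 ?_
  have hsing : (cdf (gaussianReal 0 1)).measure {x} = 0 := by
    rw [measure_cdf]
    exact gaussianReal_absolutelyContinuous 0 one_ne_zero (by simp)
  rw [StieltjesFunction.measure_singleton, ENNReal.ofReal_eq_zero] at hsing
  rw [StieltjesFunction.rightLim_eq]
  exact le_antisymm (hmono.leftLim_le le_rfl) (by linarith)

lemma measurable_stdNormalCdf : Measurable stdNormalCdf := continuous_stdNormalCdf.measurable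

lemma stdNormalCdf_pos (x : ℝ) : 0 < stdNormalCdf x :=
  (cdf_nonneg _ (x - 1)).trans_lt (stdNormalCdf_strictMono (by linarith))

lemma stdNormalCdf_lt_one (x : ℝ) : stdNormalCdf x < 1 :=
  (stdNormalCdf_strictMono (by linarith)).trans_le (cdf_le_one _ (x + 1))

lemma exists_stdNormalCdf_eq {p : ℝ} (h0 : 0 < p) (h1 : p < 1) : ∃ x, stdNormalCdf x = p := by
  obtain ⟨a, ha⟩ := ((tendsto_cdf_atBot (gaussianReal 0 1)).eventually_lt_const h0).exists
  obtain ⟨b, hb⟩ := ((tendsto_cdf_atTop (gaussianReal 0 1)).eventually_const_lt h1).exists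
  exact mem_range_of_exists_le_of_exists_ge continuous_stdNormalCdf ⟨a, ha.le⟩ ⟨b, hb.le⟩

@[simp]
lemma stdNormalQuantile_stdNormalCdf (x : ℝ) : stdNormalQuantile (stdNormalCdf x) = x := by
  have : {y : ℝ | stdNormalCdf x ≤ stdNormalCdf y} = Ici x := by
    ext y
    simp [stdNormalCdf_strictMono.le_iff_le]
  rw [stdNormalQuantile, this, csInf_Ici]

/-- The probability integral transform for the standard normal law. -/
lemma map_stdNormalCdf_gaussianReal :
    (gaussianReal 0 1).map stdNormalCdf = volume.restrict (Icc (0 : ℝ) 1) := by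
  have : IsProbabilityMeasure ((gaussianReal 0 1).map stdNormalCdf) :=
    Measure.isProbabilityMeasure_map measurable_stdNormalCdf.aemeasurable
  refine Measure.ext_of_Iic _ _ fun p => ?_
  rw [Measure.map_apply measurable_stdNormalCdf measurableSet_Iic,
    Measure.restrict_apply measurableSet_Iic]
  rcases le_or_gt p 0 with hp0 | hp0
  · have h : stdNormalCdf ⁻¹' Iic p = ∅ := by
      ext x
      simpa using hp0.trans_lt (stdNormalCdf_pos x)
    rw [h, measure_empty]
    refine (measure_mono_null (t := {0}) ?_ (by simp)).symm
    rintro x ⟨hx, hx0, -⟩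
    exact le_antisymm (hx.trans hp0) hx0
  rcases le_or_gt 1 p with hp1 | hp1
  · have h : stdNormalCdf ⁻¹' Iic p = univ := by
      ext x
      simpa using (stdNormalCdf_lt_one x).le.trans hp1
    have h' : Iic p ∩ Icc (0 : ℝ) 1 = Icc 0 1 :=
      inter_eq_right.2 fun x hx => hx.2.trans hp1
    rw [h, h', measure_univ, Real.volume_Icc]
    simp
  · obtain ⟨a, rfl⟩ := exists_stdNormalCdf_eq hp0 hp1
    have h : stdNormalCdf ⁻¹' Iic (stdNormalCdf a) = Iic a := by
      ext x
      simp [stdNormalCdf_strictMono.le_iff_le]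
    have h' : Iic (stdNormalCdf a) ∩ Icc (0 : ℝ) 1 = Icc 0 (stdNormalCdf a) := by
      ext x
      simp only [mem_inter_iff, mem_Iic, mem_Icc]
      exact ⟨fun h => ⟨h.2.1, h.1⟩, fun h => ⟨h.2, h.1, h.2.trans hp1.le⟩⟩
    rw [h, h', ← ofReal_stdNormalCdf, Real.volume_Icc, sub_zero]

/-- A closed lower set of reals is recovered from its standard normal probability. -/
lemma setOf_stdNormalCdf_le_real {S : Set ℝ} (hS : IsLowerSet S) (hSc : IsClosed S) :
    {w | stdNormalCdf w ≤ (gaussianReal 0 1).real S} = S := by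
  -- `Φ` lies strictly between 0 and 1, so the empty set (probability 0) and the whole line
  -- (probability 1) are recovered too.
  rcases S.eq_empty_or_nonempty with rfl | hne
  · ext w
    simpa using stdNormalCdf_pos w
  by_cases hb : BddAbove S
  · have : S = Iic (sSup S) := by
      ext w
      exact ⟨fun hw => le_csSup hb hw, fun hw => hS hw (hSc.csSup_mem hne hb)⟩
    rw [this, ← stdNormalCdf_eq_real]
    ext w
    simp [stdNormalCdf_strictMono.le_iff_le]
  · have : S = univ := by
      ext w
      obtain ⟨y, hy, hwy⟩ := not_bddAbove_iff.1 hb w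
      simpa using hS hwy.le hy
    rw [this]
    ext w
    simpa using (stdNormalCdf_lt_one w).le

end StdNormal

/-! ### Densities and image measures. -/

section Density

lemma map_withDensity_comp {α β : Type*} [MeasurableSpace α] [MeasurableSpace β] {μ : Measure α}
    {φ : α → β} (hφ : MeasurableEmbedding φ) (f : β → ENNReal) :
    (μ.withDensity (fun x => f (φ x))).map φ = (μ.map φ).withDensity f := by
  ext s hs
  rw [Measure.map_apply hφ.measurable hs, withDensity_apply _ (hφ.measurable hs),
    withDensity_apply _ hs, hφ.restrict_map, hφ.lintegral_map]

variable {n : ℕ}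

lemma pi_gaussianReal_eq_withDensity :
    Measure.pi (fun _ : Fin n => gaussianReal 0 1) =
      volume.withDensity (fun x => ENNReal.ofReal (∏ i, gaussianPDFReal 0 1 (x i))) := by
  refine (Measure.pi_eq fun s hs => ?_)
  rw [withDensity_apply _ (MeasurableSet.univ_pi hs), volume_pi, Measure.restrict_pi_pi,
    ← ofReal_integral_eq_lintegral_ofReal,
    integral_fintype_prod_eq_prod (f := fun _ x => gaussianPDFReal 0 1 x),
    ENNReal.ofReal_prod_of_nonneg]
  · refine Finset.prod_congr rfl fun i _ => ?_
    rw [gaussianReal_apply_eq_integral 0 one_ne_zero]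
  · exact fun i _ => integral_nonneg fun x => gaussianPDFReal_nonneg _ _ _
  · exact Integrable.fintype_prod fun i => (integrable_gaussianPDFReal 0 1).restrict
  · exact ae_of_all _ fun x => Finset.prod_nonneg fun i _ => gaussianPDFReal_nonneg _ _ _

end Density

/-! ### The Gaussian copula law as an image of `N(0, R)`. -/

section GaussianLaw
open Matrix
open scoped MatrixOrder

variable {n : ℕ}

lemma multivariateGaussian_map_ofLp (R : Matrix (Fin n) (Fin n) ℝ) :
    (multivariateGaussian 0 R).map (fun z => z.ofLp) =
      (Measure.pi (fun _ : Fin n => gaussianReal 0 1)).map (fun x => CFC.sqrt R *ᵥ x) := by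
  rw [multivariateGaussian, ← map_pi_eq_stdGaussian, Measure.map_map (by fun_prop) (by fun_prop),
    Measure.map_map (by fun_prop) (by fun_prop)]
  congr 1
  ext x i
  simp

/-- With `b = det √R`, this identifies the Jacobian factor of `x ↦ √R x` with the `-½ log det R`
term of the copula density. -/
lemma exp_neg_half_log_sq (b : ℝ) (hb : b ≠ 0) :
    Real.exp (-(1 / 2) * Real.log (b * b)) = |b⁻¹| := by
  rw [Real.log_mul hb hb, show -(1 / 2) * (Real.log b + Real.log b) = - Real.log b by ring,
    ← Real.log_inv, ← Real.log_abs, Real.exp_log (by positivity)]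

/-- The density of a centred Gaussian law with respect to the standard one. -/
lemma map_mulVec_sqrt_pi_gaussianReal {R : Matrix (Fin n) (Fin n) ℝ} (hR : R.PosDef) :
    (Measure.pi (fun _ : Fin n => gaussianReal 0 1)).map (fun x => CFC.sqrt R *ᵥ x) =
      (Measure.pi (fun _ : Fin n => gaussianReal 0 1)).withDensity (fun z => ENNReal.ofReal
        (Real.exp (-(1 / 2) * Real.log R.det - (1 / 2) * (z ⬝ᵥ ((R⁻¹ - 1) *ᵥ z))))) := by
  set B := CFC.sqrt R with hB
  have hBB : B * B = R := CFC.sqrt_mul_sqrt_self _ hR.posSemidef.nonneg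
  have hBt : Bᵀ = B := by
    have := (CFC.sqrt_nonneg R).isSelfAdjoint
    simpa [IsSelfAdjoint, star_eq_conjTranspose] using this
  have hdet : B.det * B.det = R.det := by rw [← det_mul, hBB]
  have hdet0 : B.det ≠ 0 := fun h => hR.det_pos.ne' (by rw [← hdet, h, zero_mul])
  have hunit : IsUnit B.det := hdet0.isUnit
  have hcont : Continuous (fun x : Fin n → ℝ => B *ᵥ x) := by fun_prop
  have hemb : MeasurableEmbedding (fun x : Fin n → ℝ => B *ᵥ x) :=
    hcont.measurableEmbedding (mulVec_injective_of_isUnit ((isUnit_iff_isUnit_det B).2 hunit))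
  have hvol : (volume : Measure (Fin n → ℝ)).map (fun x => B *ᵥ x) =
      ENNReal.ofReal |B.det⁻¹| • volume := by
    have := Real.map_matrix_volume_pi_eq_smul_volume_pi hdet0
    exact this
  have hquad (z : Fin n → ℝ) : ∑ i, ((B⁻¹ *ᵥ z) i) ^ 2 = z ⬝ᵥ (R⁻¹ *ᵥ z) := by
    have h1 : ∑ i, ((B⁻¹ *ᵥ z) i) ^ 2 = (B⁻¹ *ᵥ z) ⬝ᵥ (B⁻¹ *ᵥ z) := by
      simp [dotProduct, sq]
    have h2 : (B⁻¹)ᵀ = B⁻¹ := by rw [transpose_nonsing_inv, hBt]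
    rw [h1, dotProduct_mulVec, ← mulVec_transpose, h2, mulVec_mulVec, ← Matrix.mul_inv_rev, hBB,
      dotProduct_comm]
  set g : (Fin n → ℝ) → ENNReal :=
    fun x => ENNReal.ofReal (∏ i, gaussianPDFReal 0 1 (x i)) with hg
  have hgm : Measurable g := by
    refine ENNReal.measurable_ofReal.comp (Finset.measurable_prod _ fun i _ => ?_)
    exact (measurable_gaussianPDFReal 0 1).comp (measurable_pi_apply i)
  -- Writing `g` as a function of `B x` puts it in the form required by `map_withDensity_comp`.
  have hginv : (fun x => g (B⁻¹ *ᵥ (B *ᵥ x))) = g := by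
    funext x
    rw [mulVec_mulVec, nonsing_inv_mul _ hunit, one_mulVec]
  have hprod (x : Fin n → ℝ) : ∏ i, gaussianPDFReal 0 1 (x i) =
      (∏ _i : Fin n, (√(2 * Real.pi))⁻¹) * Real.exp (-(1 / 2) * ∑ i, x i ^ 2) := by
    rw [Finset.mul_sum, Real.exp_sum, ← Finset.prod_mul_distrib]
    refine Finset.prod_congr rfl fun i _ => ?_
    simp only [gaussianPDFReal, NNReal.coe_one, mul_one, sub_zero]
    congr 2
    ring
  rw [pi_gaussianReal_eq_withDensity, ← withDensity_mul _ hgm (by fun_prop)]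
  change (volume.withDensity g).map _ = _
  rw [← hginv, map_withDensity_comp hemb (fun y => g (B⁻¹ *ᵥ y)), hvol, withDensity_smul_measure,
    ← withDensity_smul' _ _ ENNReal.ofReal_ne_top, hginv]
  congr 1
  funext z
  simp only [Pi.smul_apply, smul_eq_mul, Pi.mul_apply, hg]
  rw [← ENNReal.ofReal_mul (abs_nonneg _), ← ENNReal.ofReal_mul
    (Finset.prod_nonneg fun i _ => gaussianPDFReal_nonneg _ _ _), hprod, hprod, hquad,
    ← exp_neg_half_log_sq _ hdet0, hdet]
  congr 1
  have hz : ∑ i, z i ^ 2 = z ⬝ᵥ z := by simp [dotProduct, sq]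
  rw [sub_mulVec, one_mulVec, dotProduct_sub, hz, mul_left_comm, mul_assoc, ← Real.exp_add,
    ← Real.exp_add]
  congr 2
  ring

lemma measurableEmbedding_stdNormalCdf :
    MeasurableEmbedding (fun (z : Fin n → ℝ) i => stdNormalCdf (z i)) := by
  have hc : Continuous (fun (z : Fin n → ℝ) i => stdNormalCdf (z i)) :=
    continuous_pi fun i => continuous_stdNormalCdf.comp (continuous_apply i)
  refine hc.measurableEmbedding fun x y h => ?_
  funext i
  exact stdNormalCdf_strictMono.injective (congrFun h i)

lemma measurable_stdNormalCdf_euclidean :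
    Measurable (fun (z : EuclideanSpace ℝ (Fin n)) i => stdNormalCdf (z i)) :=
  measurable_pi_lambda _ fun i => measurable_stdNormalCdf.comp (by fun_prop)

/-- The law of a Gaussian copula is the law of `(Φ(Z₁), …, Φ(Zₙ))` with `Z ∼ N(0, R)`, whether or
not `R` is invertible. -/
lemma gaussianCopulaLaw_eq_map {R : Matrix (Fin n) (Fin n) ℝ} (hR : R.PosSemidef) :
    gaussianCopulaLaw R = (multivariateGaussian 0 R).map (fun z i => stdNormalCdf (z i)) := by
  rw [gaussianCopulaLaw]
  split_ifs with hu
  · have hpd : R.PosDef := hR.posDef_iff_isUnit.2 hu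
    have hcomp : (multivariateGaussian 0 R).map (fun z i => stdNormalCdf (z i)) =
        ((multivariateGaussian 0 R).map (fun z => z.ofLp)).map
          (fun z i => stdNormalCdf (z i)) := by
      rw [Measure.map_map measurableEmbedding_stdNormalCdf.measurable (by fun_prop)]
      rfl
    have hden (z : Fin n → ℝ) :
        Real.exp (-(1 / 2) * Real.log R.det - (1 / 2) * (z ⬝ᵥ ((R⁻¹ - 1) *ᵥ z))) =
          gaussianCopulaDensity R (fun i => stdNormalCdf (z i)) := by
      simp [gaussianCopulaDensity]
    rw [hcomp, multivariateGaussian_map_ofLp, map_mulVec_sqrt_pi_gaussianReal hpd]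
    simp_rw [hden]
    -- `Φ` carries the standard Gaussian product to Lebesgue measure on the cube, so the density
    -- relative to the former becomes the copula density.
    rw [map_withDensity_comp measurableEmbedding_stdNormalCdf
      (fun u => ENNReal.ofReal (gaussianCopulaDensity R u)), Measure.pi_map_pi]
    · rw [map_stdNormalCdf_gaussianReal, ← Measure.restrict_pi_pi, ← volume_pi, pi_univ_Icc]
      rfl
    · exact fun i => measurable_stdNormalCdf.aemeasurable
  · rfl

lemma isProbabilityMeasure_gaussianCopulaLaw {R : Matrix (Fin n) (Fin n) ℝ} (hR : R.PosSemidef) :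
    IsProbabilityMeasure (gaussianCopulaLaw R) := by
  rw [gaussianCopulaLaw_eq_map hR]
  exact Measure.isProbabilityMeasure_map measurable_stdNormalCdf_euclidean.aemeasurable

lemma gaussianCopulaLaw_map_eval {R : Matrix (Fin n) (Fin n) ℝ} (hR : IsCorrelationMatrix R)
    (i : Fin n) :
    (gaussianCopulaLaw R).map (fun x => x i) = volume.restrict (Icc (0 : ℝ) 1) := by
  rw [gaussianCopulaLaw_eq_map hR.posSemidef,
    Measure.map_map (by fun_prop) measurable_stdNormalCdf_euclidean]
  have h := (measurePreserving_eval_multivariateGaussian (μ := 0) hR.posSemidef (i := i)).map_eq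
  rw [hR.diag_eq_one i] at h
  rw [← map_stdNormalCdf_gaussianReal,
    show gaussianReal 0 1 = gaussianReal ((0 : EuclideanSpace ℝ (Fin n)) i) (1 : ℝ).toNNReal by
      simp, ← h, Measure.map_map measurable_stdNormalCdf (by fun_prop)]
  rfl

lemma gaussianCopulaLaw_real_Iic {R : Matrix (Fin n) (Fin n) ℝ} (hR : R.PosSemidef)
    (u : Fin n → ℝ) :
    (gaussianCopulaLaw R).real (Iic u) =
      (multivariateGaussian 0 R).real {z | ∀ i, stdNormalCdf (z i) ≤ u i} := by
  rw [gaussianCopulaLaw_eq_map hR,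
    map_measureReal_apply measurable_stdNormalCdf_euclidean measurableSet_Iic]
  rfl

end GaussianLaw

/-! ### The matrix `R` and the factor representation of `N(0, R)`. -/

section OuterCorrelation
open Matrix
open scoped RealInnerProductSpace

variable {d : ℕ} {A : Matrix (Fin d) (Fin d) ℝ} {Δ : Fin d → ℝ}

lemma outerCorrelation_apply (A : Matrix (Fin d) (Fin d) ℝ) (Δ : Fin d → ℝ) (i j : Fin d) :
    outerCorrelation A Δ i j = √(1 - Δ i ^ 2) * A i j * √(1 - Δ j ^ 2) + Δ i * Δ j := by
  simp [outerCorrelation, vecMulVec_apply]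

lemma outerCorrelation_posSemidef (hA : A.PosSemidef) : (outerCorrelation A Δ).PosSemidef := by
  refine PosSemidef.add ?_ ?_
  · simpa using hA.mul_mul_conjTranspose_same (diagonal fun i => √(1 - Δ i ^ 2))
  · simpa using posSemidef_vecMulVec_self_star Δ

lemma outerCorrelation_isCorrelationMatrix (hA : IsCorrelationMatrix A) (hΔ : ∀ i, Δ i ^ 2 ≤ 1) :
    IsCorrelationMatrix (outerCorrelation A Δ) where
  posSemidef := outerCorrelation_posSemidef hA.posSemidef
  diag_eq_one i := by
    rw [outerCorrelation_apply, hA.diag_eq_one, mul_one, Real.mul_self_sqrt (by linarith [hΔ i])]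
    ring

lemma outerCorrelation_isUnit (hA : A.PosSemidef) (hu : IsUnit A) (hΔ : ∀ i, |Δ i| < 1) :
    IsUnit (outerCorrelation A Δ) := by
  have hpd : A.PosDef := hA.posDef_iff_isUnit.2 hu
  have hD : IsUnit (diagonal fun i => √(1 - Δ i ^ 2)) := by
    rw [isUnit_iff_isUnit_det, det_diagonal]
    refine (Finset.prod_ne_zero_iff.2 fun i _ => ?_).isUnit
    have := (sq_lt_one_iff_abs_lt_one (Δ i)).2 (hΔ i)
    exact (Real.sqrt_pos.2 (by linarith)).ne'
  have h1 : (diagonal (fun i => √(1 - Δ i ^ 2)) * A *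
      diagonal (fun i => √(1 - Δ i ^ 2))).PosDef := by
    have := hA.mul_mul_conjTranspose_same (diagonal fun i => √(1 - Δ i ^ 2))
    rw [diagonal_conjTranspose] at this
    exact this.posDef_iff_isUnit.2 ((hD.mul hu).mul hD)
  have h2 : (vecMulVec Δ Δ).PosSemidef := by simpa using posSemidef_vecMulVec_self_star Δ
  exact (h1.add_posSemidef h2).isUnit

/-- If `Z₀` is standard normal and independent of `V ∼ N(0, A)`, then `Δ Z₀ + D^{1/2} V` has
covariance matrix `D^{1/2} A D^{1/2} + Δ Δᵀ`. -/
lemma map_factor_multivariateGaussian (hA : A.PosSemidef) :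
    ((gaussianReal 0 1).prod (multivariateGaussian 0 A)).map
      (fun p => WithLp.toLp 2 fun i => Δ i * p.1 + √(1 - Δ i ^ 2) * p.2 i) =
    multivariateGaussian 0 (outerCorrelation A Δ) := by
  have hm : Measurable (fun p : ℝ × EuclideanSpace ℝ (Fin d) =>
      WithLp.toLp 2 fun i => Δ i * p.1 + √(1 - Δ i ^ 2) * p.2 i) := by fun_prop
  have : IsProbabilityMeasure (((gaussianReal 0 1).prod (multivariateGaussian 0 A)).map
      (fun p => WithLp.toLp 2 fun i => Δ i * p.1 + √(1 - Δ i ^ 2) * p.2 i)) :=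
    Measure.isProbabilityMeasure_map hm.aemeasurable
  refine Measure.ext_of_charFun (E := EuclideanSpace ℝ (Fin d)) ?_
  funext x
  -- `y = D^{1/2} x` separates `Z₀` from `V` in the inner product, so the characteristic function
  -- factors.
  set y : EuclideanSpace ℝ (Fin d) := WithLp.toLp 2 fun i => √(1 - Δ i ^ 2) * x i with hy
  have hinner (p : ℝ × EuclideanSpace ℝ (Fin d)) :
      ⟪WithLp.toLp 2 fun i => Δ i * p.1 + √(1 - Δ i ^ 2) * p.2 i, x⟫ =
        (Δ ⬝ᵥ x.ofLp) * p.1 + ⟪p.2, y⟫ := by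
    simp only [PiLp.inner_apply, dotProduct, hy, Finset.sum_mul, ← Finset.sum_add_distrib]
    refine Finset.sum_congr rfl fun i _ => ?_
    simp
    ring
  have hquad : x.ofLp ⬝ᵥ (outerCorrelation A Δ *ᵥ x.ofLp) =
      (Δ ⬝ᵥ x.ofLp) ^ 2 + y.ofLp ⬝ᵥ (A *ᵥ y.ofLp) := by
    rw [sq, show Δ ⬝ᵥ x.ofLp = ∑ i, Δ i * x.ofLp i from rfl, Finset.sum_mul_sum]
    simp only [dotProduct, mulVec, outerCorrelation_apply, hy, Finset.mul_sum,
      ← Finset.sum_add_distrib]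
    refine Finset.sum_congr rfl fun i _ => Finset.sum_congr rfl fun j _ => ?_
    ring
  rw [charFun_multivariateGaussian (outerCorrelation_posSemidef hA), hquad, charFun_apply,
    integral_map hm.aemeasurable (by fun_prop)]
  simp_rw [hinner, Complex.ofReal_add, add_mul, Complex.exp_add]
  rw [integral_prod_mul (fun z : ℝ => Complex.exp (((Δ ⬝ᵥ x.ofLp * z : ℝ) : ℂ) * Complex.I))
    (fun v : EuclideanSpace ℝ (Fin d) => Complex.exp ((⟪v, y⟫ : ℝ) * Complex.I)),
    ← charFun_apply, charFun_multivariateGaussian hA]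
  simp_rw [Complex.ofReal_mul]
  rw [← charFun_apply_real, charFun_gaussianReal, ← Complex.exp_add]
  congr 1
  simp
  ring

end OuterCorrelation

/-! ### Conditioning on the factor, and the linking copulas. -/

section Factor

variable {d : ℕ}

lemma measureReal_prod_eq_integral {α β : Type*} [MeasurableSpace α] [MeasurableSpace β]
    {μ : Measure α} {ν : Measure β} [IsFiniteMeasure μ] [IsFiniteMeasure ν] {s : Set (α × β)}
    (hs : MeasurableSet s) :
    (μ.prod ν).real s = ∫ x, ν.real (Prod.mk x ⁻¹' s) ∂μ := by
  rw [measureReal_def, Measure.prod_apply hs, ← integral_toReal]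
  · rfl
  · exact (measurable_measure_prodMk_left hs).aemeasurable
  · exact ae_of_all _ fun x => measure_lt_top _ _

/-- The conditional probability of `{Φ(Δᵢ Z₀ + √(1 - Δᵢ²) Vᵢ) ≤ uᵢ for all i}`, with `V ∼ N(0, A)`,
given `Z₀ = z`. -/
noncomputable def factorProb (A : Matrix (Fin d) (Fin d) ℝ) (Δ u : Fin d → ℝ) (z : ℝ) : ℝ :=
  (multivariateGaussian 0 A).real {v | ∀ i, stdNormalCdf (Δ i * z + √(1 - Δ i ^ 2) * v i) ≤ u i}

/-- The conditional probability of `{Φ(ρ Z₀ + √(1 - ρ²) W) ≤ u}`, with `W` standard normal, given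
`Z₀ = z`. -/
noncomputable def linkProb (ρ u z : ℝ) : ℝ :=
  (gaussianReal 0 1).real {w | stdNormalCdf (ρ * z + √(1 - ρ ^ 2) * w) ≤ u}

lemma measurableSet_factor (Δ u : Fin d → ℝ) :
    MeasurableSet {p : ℝ × EuclideanSpace ℝ (Fin d) |
      ∀ i, stdNormalCdf (Δ i * p.1 + √(1 - Δ i ^ 2) * p.2 i) ≤ u i} := by
  simp only [ofPred_forall]
  refine MeasurableSet.iInter fun i => measurableSet_le ?_ measurable_const
  exact measurable_stdNormalCdf.comp (by fun_prop)

lemma integrable_factorProb (A : Matrix (Fin d) (Fin d) ℝ) (Δ u : Fin d → ℝ) :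
    Integrable (factorProb A Δ u) (gaussianReal 0 1) :=
  Measure.integrable_measure_prodMk_left (ν := multivariateGaussian 0 A)
    (measurableSet_factor Δ u) (measure_ne_top _ _)

lemma multivariateGaussian_outerCorrelation_real {A : Matrix (Fin d) (Fin d) ℝ}
    (hA : A.PosSemidef) (Δ u : Fin d → ℝ) :
    (multivariateGaussian 0 (outerCorrelation A Δ)).real {z | ∀ i, stdNormalCdf (z i) ≤ u i} =
      ∫ z, factorProb A Δ u z ∂(gaussianReal 0 1) := by
  have hm : Measurable (fun p : ℝ × EuclideanSpace ℝ (Fin d) =>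
      WithLp.toLp 2 fun i => Δ i * p.1 + √(1 - Δ i ^ 2) * p.2 i) := by fun_prop
  have hs : MeasurableSet {z : EuclideanSpace ℝ (Fin d) | ∀ i, stdNormalCdf (z i) ≤ u i} :=
    measurable_stdNormalCdf_euclidean (measurableSet_Iic (a := u))
  rw [← map_factor_multivariateGaussian hA, map_measureReal_apply hm hs,
    measureReal_prod_eq_integral (hm hs)]
  rfl

lemma measurableEmbedding_stdNormalCdf_real : MeasurableEmbedding stdNormalCdf :=
  continuous_stdNormalCdf.measurableEmbedding stdNormalCdf_strictMono.injective

lemma integral_comp_stdNormalQuantile (F : ℝ → ℝ) :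
    ∫ t in (0 : ℝ)..1, F (stdNormalQuantile t) = ∫ z, F z ∂(gaussianReal 0 1) := by
  rw [intervalIntegral.integral_of_le zero_le_one, ← integral_Icc_eq_integral_Ioc,
    ← map_stdNormalCdf_gaussianReal, measurableEmbedding_stdNormalCdf_real.integral_map]
  simp

lemma intervalIntegrable_comp_stdNormalQuantile {F : ℝ → ℝ}
    (hF : Integrable F (gaussianReal 0 1)) :
    IntervalIntegrable (fun t => F (stdNormalQuantile t)) volume 0 1 := by
  rw [intervalIntegrable_iff_integrableOn_Icc_of_le zero_le_one, IntegrableOn,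
    ← map_stdNormalCdf_gaussianReal, measurableEmbedding_stdNormalCdf_real.integrable_map_iff]
  simpa [Function.comp_def] using hF

lemma sq_le_one_of_isCorrelationMatrix {ρ : ℝ} (h : IsCorrelationMatrix (corrMatrix₂ ρ)) :
    ρ ^ 2 ≤ 1 := by
  have := h.posSemidef.det_nonneg
  rw [corrMatrix₂, Matrix.det_fin_two_of] at this
  linarith

/-- Loading 1 leaves no noise in the second coordinate, which is therefore the factor itself. -/
lemma outerCorrelation_one_eq_corrMatrix₂ {ρ : ℝ} (hρ : ρ ^ 2 ≤ 1) :
    outerCorrelation 1 ![ρ, 1] = corrMatrix₂ ρ := by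
  ext i j
  rw [outerCorrelation_apply]
  fin_cases i <;> fin_cases j <;> simp [corrMatrix₂]
  rw [Real.mul_self_sqrt (by linarith)]
  ring

lemma factorProb_one_pair (ρ u t z : ℝ) :
    factorProb 1 ![ρ, 1] ![u, t] z = (Iic t).indicator (fun _ => linkProb ρ u z)
      (stdNormalCdf z) := by
  have hset : {v : EuclideanSpace ℝ (Fin 2) | ∀ i, stdNormalCdf
      (![ρ, 1] i * z + √(1 - ![ρ, 1] i ^ 2) * v i) ≤ ![u, t] i} =
      {v | stdNormalCdf (ρ * z + √(1 - ρ ^ 2) * v 0) ≤ u ∧ stdNormalCdf z ≤ t} := by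
    ext v
    simp [Fin.forall_fin_two]
  rw [factorProb, hset]
  by_cases ht : stdNormalCdf z ≤ t
  · rw [indicator_of_mem (mem_Iic.2 ht)]
    have h := (measurePreserving_eval_multivariateGaussian (ι := Fin 2) (μ := 0)
      (Matrix.PosSemidef.one (R := ℝ)) (i := 0))
    simp only [Matrix.one_apply_eq, Real.toNNReal_one, PiLp.zero_apply] at h
    rw [linkProb, ← h.measureReal_preimage]
    · simp [ht]
    · refine (measurableSet_le (measurable_stdNormalCdf.comp ?_)
        measurable_const).nullMeasurableSet
      fun_prop
  · rw [indicator_of_notMem (by simpa using ht)]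
    simp [ht]

lemma integrable_linkProb (ρ u : ℝ) : Integrable (linkProb ρ u) (gaussianReal 0 1) := by
  refine Measure.integrable_measure_prodMk_left (ν := gaussianReal 0 1)
    (s := {p : ℝ × ℝ | stdNormalCdf (ρ * p.1 + √(1 - ρ ^ 2) * p.2) ≤ u}) ?_ (measure_ne_top _ _)
  refine measurableSet_le (measurable_stdNormalCdf.comp ?_) measurable_const
  fun_prop

lemma link_eq_integral {ρ : ℝ} {C : (Fin 2 → ℝ) → ℝ} (hC : IsGaussianCopula (corrMatrix₂ ρ) C)
    {u t : ℝ} (hu : u ∈ Icc (0 : ℝ) 1) (ht : t ∈ Icc (0 : ℝ) 1) :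
    C ![u, t] = ∫ s in (0 : ℝ)..t, linkProb ρ u (stdNormalQuantile s) := by
  have hmem : ![u, t] ∈ Icc (0 : Fin 2 → ℝ) 1 := by
    constructor <;> intro i <;> fin_cases i <;> simp [hu.1, hu.2, ht.1, ht.2]
  have hρ := sq_le_one_of_isCorrelationMatrix hC.isCorrelationMatrix
  rw [hC.isCopula.eq_cdf _ hmem, gaussianCopulaLaw_real_Iic hC.isCorrelationMatrix.posSemidef,
    ← outerCorrelation_one_eq_corrMatrix₂ hρ,
    multivariateGaussian_outerCorrelation_real Matrix.PosSemidef.one]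
  simp_rw [factorProb_one_pair]
  -- The quantile inverts `Φ`, so the integrand is a function of `Φ(z)` and the integral moves to
  -- `[0, 1]`.
  have hind : ∀ z, (Iic t).indicator (fun _ => linkProb ρ u z) (stdNormalCdf z) =
      (Iic t).indicator (fun s => linkProb ρ u (stdNormalQuantile s)) (stdNormalCdf z) := by
    intro z
    simp [indicator]
  simp_rw [hind]
  rw [← measurableEmbedding_stdNormalCdf_real.integral_map, map_stdNormalCdf_gaussianReal,
    integral_indicator measurableSet_Iic, Measure.restrict_restrict measurableSet_Iic,
    intervalIntegral.integral_of_le ht.1, ← integral_Icc_eq_integral_Ioc]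
  congr 2
  ext s
  simp only [mem_inter_iff, mem_Iic, mem_Icc]
  exact ⟨fun h => ⟨h.2.1, h.1⟩, fun h => ⟨h.2, h.1, h.2.trans ht.2⟩⟩

lemma ae_hasDerivAt_link {ρ : ℝ} {C : (Fin 2 → ℝ) → ℝ} (hC : IsGaussianCopula (corrMatrix₂ ρ) C)
    {u : ℝ} (hu : u ∈ Icc (0 : ℝ) 1) :
    ∀ᵐ t ∂(volume.restrict (Ioo (0 : ℝ) 1)),
      HasDerivAt (fun s => C ![u, s]) (linkProb ρ u (stdNormalQuantile t)) t := by
  rw [ae_restrict_iff' measurableSet_Ioo]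
  filter_upwards [(intervalIntegrable_comp_stdNormalQuantile
    (integrable_linkProb ρ u)).ae_hasDerivAt_integral] with t ht htI
  have h01 : t ∈ uIcc (0 : ℝ) 1 := by
    rw [uIcc_of_le zero_le_one]
    exact Ioo_subset_Icc_self htI
  -- The integral formula is known only for arguments in `[0, 1]`, which contains a neighbourhood of
  -- the interior point `t`.
  refine (ht h01 0 left_mem_uIcc).congr_of_eventuallyEq ?_
  filter_upwards [isOpen_Ioo.mem_nhds htI] with s hs
  exact link_eq_integral hC hu (Ioo_subset_Icc_self hs)

/-- The set measured by `linkProb` is closed and, since `√(1 - ρ²) ≥ 0`, a lower set; such a set is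
determined by its normal probability. No division by `√(1 - ρ²)` occurs, so `|ρ| = 1` needs no
separate case. -/
lemma stdNormalCdf_le_linkProb_iff (ρ u z w : ℝ) :
    stdNormalCdf w ≤ linkProb ρ u z ↔ stdNormalCdf (ρ * z + √(1 - ρ ^ 2) * w) ≤ u := by
  have hl : IsLowerSet {w | stdNormalCdf (ρ * z + √(1 - ρ ^ 2) * w) ≤ u} := by
    intro a b hba ha
    refine (stdNormalCdf_strictMono.monotone ?_).trans ha
    gcongr
  have hc : IsClosed {w | stdNormalCdf (ρ * z + √(1 - ρ ^ 2) * w) ≤ u} :=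
    isClosed_le (continuous_stdNormalCdf.comp (by fun_prop)) continuous_const
  exact Set.ext_iff.1 (setOf_stdNormalCdf_le_real hl hc) w

lemma gaussianCopula_linkProb {A : Matrix (Fin d) (Fin d) ℝ} {CA : (Fin d → ℝ) → ℝ}
    (hCA : IsGaussianCopula A CA) (Δ u : Fin d → ℝ) (z : ℝ) :
    CA (fun i => linkProb (Δ i) (u i) z) = factorProb A Δ u z := by
  have hmem : (fun i => linkProb (Δ i) (u i) z) ∈ Icc (0 : Fin d → ℝ) 1 :=
    ⟨fun i => measureReal_nonneg, fun i => measureReal_le_one⟩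
  rw [hCA.isCopula.eq_cdf _ hmem, gaussianCopulaLaw_real_Iic hCA.isCorrelationMatrix.posSemidef, factorProb]
  simp_rw [stdNormalCdf_le_linkProb_iff]

lemma eofcIntegrand_ae_eq {A : Matrix (Fin d) (Fin d) ℝ} {Δ : Fin d → ℝ} {Q₀ : ℝ → ℝ}
    {inner : ℝ → (Fin d → ℝ) → ℝ} {CA : (Fin d → ℝ) → ℝ} {link : Fin d → (Fin 2 → ℝ) → ℝ}
    (hCA : IsGaussianCopula A CA) (hinner : ∀ x₀, inner x₀ = CA)
    (hlink : ∀ i, IsGaussianCopula (corrMatrix₂ (Δ i)) (link i))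
    {u : Fin d → ℝ} (hu : u ∈ Icc (0 : Fin d → ℝ) 1) :
    ∀ᵐ t ∂(volume.restrict (uIoc (0 : ℝ) 1)),
      factorProb A Δ u (stdNormalQuantile t) = eofcIntegrand inner Q₀ link u t := by
  -- The endpoint 1 is null; the link derivatives are controlled only on the open interval.
  rw [uIoc_of_le zero_le_one, ← restrict_Ioo_eq_restrict_Ioc]
  filter_upwards [ae_all_iff.2 fun i => ae_hasDerivAt_link (hlink i) ⟨hu.1 i, hu.2 i⟩] with t ht
  rw [eofcIntegrand, hinner, ← gaussianCopula_linkProb hCA]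
  congr 1
  funext i
  exact (ht i).deriv.symm

end Factor

end GaussCop

theorem mainTheorem1 (d : ℕ) (A : Matrix (Fin d) (Fin d) ℝ) (Δ : Fin d → ℝ)
    (Q₀ : ℝ → ℝ) (inner : ℝ → (Fin d → ℝ) → ℝ) (CA : (Fin d → ℝ) → ℝ)
    (link : Fin d → (Fin 2 → ℝ) → ℝ)
    (hCA : GaussCop.IsGaussianCopula A CA)
    (hinner : ∀ x₀, inner x₀ = CA)
    (hlink : ∀ i, GaussCop.IsGaussianCopula (GaussCop.corrMatrix₂ (Δ i)) (link i)) :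
    GaussCop.EOFCWellDefined inner Q₀ link ∧
      GaussCop.IsGaussianCopula (GaussCop.outerCorrelation A Δ)
        (GaussCop.eofcOuter inner Q₀ link) ∧
      (IsUnit A → (∀ i, |Δ i| < 1) → IsUnit (GaussCop.outerCorrelation A Δ)) := by
  have hA := hCA.isCorrelationMatrix
  have hR : GaussCop.IsCorrelationMatrix (GaussCop.outerCorrelation A Δ) :=
    GaussCop.outerCorrelation_isCorrelationMatrix hA fun i =>
      GaussCop.sq_le_one_of_isCorrelationMatrix (hlink i).isCorrelationMatrix
  refine ⟨⟨fun u hu i => ?_, fun u hu => ?_⟩, ⟨hR, ?_, ?_, fun u hu => ?_⟩,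
    GaussCop.outerCorrelation_isUnit hA.posSemidef⟩
  · filter_upwards [GaussCop.ae_hasDerivAt_link (hlink i) ⟨hu.1 i, hu.2 i⟩] with t ht
    exact ht.differentiableAt
  · exact (GaussCop.intervalIntegrable_comp_stdNormalQuantile
      (GaussCop.integrable_factorProb A Δ u)).congr_ae
        (GaussCop.eofcIntegrand_ae_eq hCA hinner hlink hu)
  · exact GaussCop.isProbabilityMeasure_gaussianCopulaLaw hR.posSemidef
  · exact GaussCop.gaussianCopulaLaw_map_eval hR
  · rw [GaussCop.eofcOuter, GaussCop.gaussianCopulaLaw_real_Iic hR.posSemidef,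
      GaussCop.multivariateGaussian_outerCorrelation_real hA.posSemidef,
      ← GaussCop.integral_comp_stdNormalQuantile]
    refine intervalIntegral.integral_congr_ae_restrict ?_
    filter_upwards [GaussCop.eofcIntegrand_ae_eq (Q₀ := Q₀) hCA hinner hlink hu] with t ht
    exact ht.symm
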